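/- Consider the $\mu$HS equation $$-u_{txx}=-2\mu(u)u_x+2u_xu_{xx}+uu_{xxx},\qquad \mu(u)=\int_0^1u\,dx,$$ for $u=u(t,x)$ of period one in $x$. A \emph{period-one traveling wave of speed $c$} is a function $u(t,x)=\varphi(x-ct)$ where $\varphi\in H^1_{loc}(\mathbb R)$ is periodic with least period $1$ and, for some $a\in\mathbb R$, satisfies $\varphi_x^2=-4\mu(\varphi)\varphi+\left((\varphi-c)^2\right)_{xx}+a$ in the sense of distributions on $\mathbb R$. It is \emph{smooth} if $\varphi\in C^\infty(\mathbb R)$; then $u$ is a classical solution of the $\mu$HS equation. It is \emph{cusped} if $\max\varphi=c$, the maximum is attained exactly once per period, $\varphi$ is smooth away from the points where $\varphi=c$, and at each such point $x_0$ the function $\varphi$ is continuous with $\varphi_x\to+\infty$ as $x\uparrow x_0$ and $\varphi_x\to-\infty$ as $x\downarrow x_0$. A \emph{one-parameter family} of such waves is a family of profiles $\varphi_s$, $s\in(0,1)$, such that $(s,x)\mapsto\varphi_s(x)$ is continuous on $(0,1)\times\mathbb R$ and $\varphi_s$, $\varphi_{s'}$ are not translates of each other for $s\ne s'$. Theorem.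 For every real $c\neq0$ the $\mu$HS equation has a one-parameter family of smooth period-one traveling waves of speed $c$, and a one-parameter family of cusped period-one traveling waves of speed $c$. -/

import Mathlib

open Set Filter Topology MeasureTheory
open scoped ContDiff

namespace MuHS

/-- The mean `μ(f)` over the unit circle of a function `f` of period one. -/
noncomputable def mean (f : ℝ → ℝ) : ℝ := ∫ x in (0 : ℝ)..1, f x

/-- `ψ ∈ C_c^∞(ℝ)`. -/
def IsTestFunction (ψ : ℝ → ℝ) : Prop := ContDiff ℝ ∞ ψ ∧ HasCompactSupport ψ

/-- `f ∈ L²_loc(ℝ)`. -/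
def MemL2Loc (f : ℝ → ℝ) : Prop :=
  ∀ K : Set ℝ, IsCompact K → MemLp f 2 (volume.restrict K)

/-- `g` is the weak (distributional) derivative of `f`, both locally integrable. -/
def HasWeakDeriv (f g : ℝ → ℝ) : Prop :=
  LocallyIntegrable f ∧ LocallyIntegrable g ∧
    ∀ ψ : ℝ → ℝ, IsTestFunction ψ → ∫ x, f x * deriv ψ x = - ∫ x, g x * ψ x

/-- `φ ∈ H¹_loc(ℝ)` is the profile of a wave `φ (x - c t)` of speed `c` for the equation
`-u_txx = -2 μ u_x + 2 u_x u_xx + u u_xxx` with real parameter `μ`: for some `a`, the identity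
`φ_x² = -4 μ φ + ((φ - c)²)_xx + a` holds in the sense of distributions. -/
def IsTravelingWave (μ c : ℝ) (φ : ℝ → ℝ) : Prop :=
  ∃ φ' : ℝ → ℝ, MemL2Loc φ ∧ MemL2Loc φ' ∧ HasWeakDeriv φ φ' ∧
    ∃ a : ℝ, ∀ ψ : ℝ → ℝ, IsTestFunction ψ →
      ∫ x, φ' x ^ 2 * ψ x =
        (∫ x, (-4 * μ * φ x + a) * ψ x) + ∫ x, (φ x - c) ^ 2 * iteratedDeriv 2 ψ x

/-- A traveling wave of speed `c` of the μHS equation with least period one: the parameter `μ`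
is the mean of the profile. -/
def IsPeriodOneWave (c : ℝ) (φ : ℝ → ℝ) : Prop :=
  Function.Periodic φ 1 ∧ (∀ T : ℝ, 0 < T → T < 1 → ¬ Function.Periodic φ T) ∧
    IsTravelingWave (mean φ) c φ

/-- `u` is a smooth classical solution, for all times, on the circle `ℝ / ℤ`, of the μHS equation
`-u_txx = -2 μ(u) u_x + 2 u_x u_xx + u u_xxx`. -/
def IsClassicalSolution (u : ℝ → ℝ → ℝ) : Prop :=
  ContDiff ℝ ∞ (fun p : ℝ × ℝ => u p.1 p.2) ∧ (∀ t, Function.Periodic (u t) 1) ∧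
    ∀ t x : ℝ,
      - deriv (fun s => iteratedDeriv 2 (u s) x) t =
        -2 * mean (u t) * deriv (u t) x + 2 * deriv (u t) x * iteratedDeriv 2 (u t) x
          + u t x * iteratedDeriv 3 (u t) x

/-- A smooth period-one traveling wave of speed `c`. -/
def IsSmoothWave (c : ℝ) (φ : ℝ → ℝ) : Prop :=
  IsPeriodOneWave c φ ∧ ContDiff ℝ ∞ φ ∧ IsClassicalSolution (fun t x => φ (x - c * t))

/-- An (upward) cusp: `f` is continuous at `x₀`, smooth on both sides of `x₀`, and its slope tends
to `+∞` from the left and to `-∞` from the right. -/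
def HasCuspAt (f : ℝ → ℝ) (x₀ : ℝ) : Prop :=
  ContinuousAt f x₀ ∧
    (∃ ε > 0, ContDiffOn ℝ ∞ f (Ioo (x₀ - ε) x₀) ∧ ContDiffOn ℝ ∞ f (Ioo x₀ (x₀ + ε))) ∧
    Tendsto (deriv f) (𝓝[<] x₀) atTop ∧ Tendsto (deriv f) (𝓝[>] x₀) atBot

/-- A cusped period-one traveling wave of speed `c`: its maximum is `c`, it is attained exactly
once per period, in a cusp, and the profile is smooth away from the cusps. -/
def IsCuspedWave (c : ℝ) (φ : ℝ → ℝ) : Prop :=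
  IsPeriodOneWave c φ ∧ (∀ x, φ x ≤ c) ∧
    (∃ x₀ : ℝ, ∀ x, φ x = c ↔ ∃ n : ℤ, x = x₀ + n) ∧
    (∀ x, φ x = c → HasCuspAt φ x) ∧ ContDiffOn ℝ ∞ φ {x | φ x ≠ c}

/-- `Φ s`, `0 < s < 1`, is a (genuine) one-parameter family of profiles with property `P`: each
member has the property, `Φ s x` is jointly continuous in `(s, x)`, and no two members with
different parameters are translates of each other. -/
def IsOneParameterFamily (P : (ℝ → ℝ) → Prop) (Φ : ℝ → ℝ → ℝ) : Prop :=
  (∀ s ∈ Ioo (0 : ℝ) 1, P (Φ s)) ∧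
    ContinuousOn (fun p : ℝ × ℝ => Φ p.1 p.2) (Ioo (0 : ℝ) 1 ×ˢ univ) ∧
    ∀ s ∈ Ioo (0 : ℝ) 1, ∀ s' ∈ Ioo (0 : ℝ) 1, s ≠ s' →
      ¬ ∃ h : ℝ, ∀ x, Φ s' x = Φ s (x + h)

end MuHS

/-! For a smooth profile, expanding the weak equation and multiplying by `φ_x` gives the first
integral `(c - φ) φ_x² = 2μ (M - φ)(φ - m)`, with `a = 2μ (M + m)`. Both families solve this by
quadrature. A phase `θ` writes the profile as `α - β sin² θ`, and position is a function of phase,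
`x = clock g θ`, with density `g = dx/dθ`.

Smooth waves oscillate between `m` and `M`, both on the same side of `c`. With `c - φ = q (k + (1 -
k) sin² θ)`, the density is proportional to the root of the bracket and never vanishes. Cusped waves
have `c - φ = q sin² θ` with `q > 0`; the density is proportional to `sin² θ / √(1 + s sin² θ)`,
whose zeros are the cusps. Position is still smooth in `θ` there, and so is the flux `((φ - c)²)_x`.
The weak equation can therefore be checked in the phase variable, by integration by parts and almost
everywhere (`IsClock.isTravelingWave`).

Normalizing the density gives period one. Requiring the parameter `μ` to be the mean is then one
linear equation for `q`, leaving the shape parameter `k` or `s` free. For smooth waves its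
coefficient is positive, so every `c ≠ 0` is allowed. For cusped waves the coefficient must have the
sign of `c`: `s ≥ 0` serves `c > 0`, and `s` in `(-1, -1/2]` serves `c < 0` (`cuspDenom_pos`,
`cuspDenom_neg`).

Translates are separated by the extreme values for smooth waves, and by amplitude together with the
slope at given heights for cusped ones. -/

namespace MuHS

/-! ### Change of variables between phase and position. -/

/-- A smooth nonnegative `π`-periodic density of total mass one per period, with only countably
many zeros. Its primitive reparametrizes the line. -/
structure IsClock (g : ℝ → ℝ) : Prop where
  contDiff : ContDiff ℝ ∞ g
  nonneg : ∀ θ, 0 ≤ g θ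
  countable_zeros : {θ | g θ = 0}.Countable
  periodic : Function.Periodic g Real.pi
  integral_eq_one : ∫ θ in (0 : ℝ)..Real.pi, g θ = 1

/-- The primitive of `g` vanishing at `0`. -/
noncomputable def clock (g : ℝ → ℝ) (θ : ℝ) : ℝ := ∫ t in (0 : ℝ)..θ, g t

/-- The inverse function of `clock g`. -/
noncomputable def phase (g : ℝ → ℝ) : ℝ → ℝ := Function.invFun (clock g)

@[simp] theorem clock_zero (g : ℝ → ℝ) : clock g 0 = 0 := by simp [clock]

namespace IsClock

variable {g : ℝ → ℝ}

theorem continuous (hg : IsClock g) : Continuous g := hg.contDiff.continuous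

theorem intervalIntegrable (hg : IsClock g) (a b : ℝ) : IntervalIntegrable g volume a b :=
  hg.continuous.intervalIntegrable a b

theorem hasDerivAt_clock (hg : IsClock g) (θ : ℝ) : HasDerivAt (clock g) (g θ) θ :=
  intervalIntegral.integral_hasDerivAt_right (hg.intervalIntegrable 0 θ)
    hg.continuous.stronglyMeasurable.stronglyMeasurableAtFilter hg.continuous.continuousAt

theorem continuous_clock (hg : IsClock g) : Continuous (clock g) :=
  continuous_iff_continuousAt.2 fun θ => (hg.hasDerivAt_clock θ).continuousAt

theorem contDiff_clock (hg : IsClock g) : ContDiff ℝ ∞ (clock g) := by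
  refine contDiff_infty_iff_deriv.2 ⟨fun θ => (hg.hasDerivAt_clock θ).differentiableAt, ?_⟩
  rw [show deriv (clock g) = g from funext fun θ => (hg.hasDerivAt_clock θ).deriv]
  exact hg.contDiff

theorem strictMono_clock (hg : IsClock g) : StrictMono (clock g) := by
  intro a b hab
  -- A nondegenerate interval is uncountable, so it is not contained in the zero set.
  obtain ⟨t, htab, ht⟩ : ∃ t ∈ Icc a b, g t ≠ 0 := by
    by_contra! h
    exact (Cardinal.Real.Icc_countable_iff.not.2 (not_le.2 hab)) (hg.countable_zeros.mono h)
  have h : 0 < ∫ x in a..b, g x :=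
    intervalIntegral.integral_pos hab hg.continuous.continuousOn (fun x _ => hg.nonneg x)
      ⟨t, htab, (hg.nonneg t).lt_of_ne' ht⟩
  have h' := intervalIntegral.integral_add_adjacent_intervals (hg.intervalIntegrable 0 a)
    (hg.intervalIntegrable a b)
  simp only [clock]
  linarith

theorem surjective_clock (hg : IsClock g) : Function.Surjective (clock g) := by
  have h0 : 0 < ∫ θ in (0 : ℝ)..Real.pi, g θ := by rw [hg.integral_eq_one]; exact one_pos
  exact hg.continuous_clock.surjective
    (hg.periodic.tendsto_atTop_intervalIntegral_of_pos h0 Real.pi_pos)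
    (hg.periodic.tendsto_atBot_intervalIntegral_of_pos h0 Real.pi_pos)

theorem clock_add_pi (hg : IsClock g) (θ : ℝ) : clock g (θ + Real.pi) = clock g θ + 1 := by
  have h := hg.periodic.intervalIntegral_add_eq_add 0 θ hg.intervalIntegrable
  rw [zero_add, hg.integral_eq_one] at h
  exact h

theorem clock_phase (hg : IsClock g) (x : ℝ) : clock g (phase g x) = x :=
  Function.rightInverse_invFun hg.surjective_clock x

theorem phase_clock (hg : IsClock g) (θ : ℝ) : phase g (clock g θ) = θ :=
  Function.leftInverse_invFun hg.strictMono_clock.injective θ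

theorem phase_zero (hg : IsClock g) : phase g 0 = 0 := by
  simpa using hg.phase_clock 0

theorem phase_add_one (hg : IsClock g) (x : ℝ) : phase g (x + 1) = phase g x + Real.pi := by
  rw [← hg.phase_clock (phase g x + Real.pi), hg.clock_add_pi, hg.clock_phase]

theorem strictMono_phase (hg : IsClock g) : StrictMono (phase g) := fun x y h => by
  rwa [← hg.strictMono_clock.lt_iff_lt, hg.clock_phase, hg.clock_phase]

theorem surjective_phase (hg : IsClock g) : Function.Surjective (phase g) :=
  fun θ => ⟨clock g θ, hg.phase_clock θ⟩

theorem continuous_phase (hg : IsClock g) : Continuous (phase g) :=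
  hg.strictMono_phase.monotone.continuous_of_surjective hg.surjective_phase

/-- `clock g` and `phase g` as a homeomorphism of the line. -/
noncomputable def homeomorph (hg : IsClock g) : ℝ ≃ₜ ℝ where
  toFun := clock g
  invFun := phase g
  left_inv := hg.phase_clock
  right_inv := hg.clock_phase
  continuous_toFun := hg.continuous_clock
  continuous_invFun := hg.continuous_phase

theorem hasDerivAt_phase (hg : IsClock g) {x : ℝ} (hx : g (phase g x) ≠ 0) :
    HasDerivAt (phase g) (g (phase g x))⁻¹ x :=
  HasDerivAt.of_local_left_inverse hg.continuous_phase.continuousAt (hg.hasDerivAt_clock _) hx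
    (Eventually.of_forall hg.clock_phase)

theorem contDiffAt_phase (hg : IsClock g) {x : ℝ} (hx : g (phase g x) ≠ 0) :
    ContDiffAt ℝ ∞ (phase g) x :=
  hg.homeomorph.toOpenPartialHomeomorph.contDiffAt_symm_deriv hx (mem_univ x)
    (hg.hasDerivAt_clock _) hg.contDiff_clock.contDiffAt

theorem ae_ne_zero (hg : IsClock g) : ∀ᵐ θ, g θ ≠ 0 := hg.countable_zeros.ae_notMem volume

theorem integral_eq (hg : IsClock g) (f : ℝ → ℝ) :
    ∫ x, f x = ∫ θ, f (clock g θ) * g θ := by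
  have h := integral_image_eq_integral_abs_deriv_smul (F := ℝ) MeasurableSet.univ
    (fun θ _ => (hg.hasDerivAt_clock θ).hasDerivWithinAt) hg.strictMono_clock.injective.injOn f
  rw [image_univ, hg.surjective_clock.range_eq] at h
  simpa [abs_of_nonneg (hg.nonneg _), mul_comm] using h

theorem integrableOn_iff (hg : IsClock g) (f : ℝ → ℝ) (K : Set ℝ) (hK : MeasurableSet K) :
    IntegrableOn f K ↔ IntegrableOn (fun θ => f (clock g θ) * g θ) (clock g ⁻¹' K) := by
  have h := integrableOn_image_iff_integrableOn_abs_deriv_smul (F := ℝ)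
    (hg.continuous_clock.measurable hK)
    (fun θ _ => (hg.hasDerivAt_clock θ).hasDerivWithinAt) hg.strictMono_clock.injective.injOn f
  rw [image_preimage_eq _ hg.surjective_clock] at h
  simpa [abs_of_nonneg (hg.nonneg _), mul_comm] using h

theorem mean_comp_phase (hg : IsClock g) {F : ℝ → ℝ} (hF : Continuous F) :
    mean (F ∘ phase g) = ∫ θ in (0 : ℝ)..Real.pi, F θ * g θ := by
  have h := intervalIntegral.integral_comp_mul_deriv (a := 0) (b := Real.pi)
    (fun θ _ => hg.hasDerivAt_clock θ) hg.continuous.continuousOn (hF.comp hg.continuous_phase)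
  have h1 := hg.clock_add_pi 0
  rw [zero_add, clock_zero, zero_add] at h1
  rw [clock_zero, h1] at h
  rw [mean, ← h]
  simp [hg.phase_clock]

theorem isTestFunction_comp_clock (hg : IsClock g) {ψ : ℝ → ℝ} (hψ : IsTestFunction ψ) :
    IsTestFunction (ψ ∘ clock g) :=
  ⟨hψ.1.comp hg.contDiff_clock, hψ.2.comp_homeomorph hg.homeomorph⟩

/-- The derivative of a function composed with `phase g`, tested against `ψ`. -/
theorem integral_comp_phase_mul_deriv (hg : IsClock g) {F F' : ℝ → ℝ}
    (hF : ∀ θ, HasDerivAt F (F' θ) θ) (hF' : Continuous F') {ψ : ℝ → ℝ} (hψ : IsTestFunction ψ) :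
    ∫ x, F (phase g x) * deriv ψ x = - ∫ θ, F' θ * ψ (clock g θ) := by
  have hFc : Continuous F := continuous_iff_continuousAt.2 fun θ => (hF θ).continuousAt
  have hv := hg.isTestFunction_comp_clock hψ
  have hd : ∀ θ, HasDerivAt (ψ ∘ clock g) (deriv ψ (clock g θ) * g θ) θ := fun θ =>
    ((hψ.1.differentiable (by simp)) _).hasDerivAt.comp θ (hg.hasDerivAt_clock θ)
  have hd' : (fun θ => deriv ψ (clock g θ) * g θ) = deriv (ψ ∘ clock g) :=
    funext fun θ => (hd θ).deriv.symm
  have hdc : Continuous (deriv (ψ ∘ clock g)) := hv.1.continuous_deriv (by simp)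
  rw [hg.integral_eq]
  simp only [hg.phase_clock, mul_assoc]
  refine integral_mul_deriv_eq_deriv_mul_of_integrable (v := ψ ∘ clock g) (fun θ _ => hF θ)
    (fun θ _ => hd θ) ?_ ?_ ?_
  · rw [hd']
    exact (hFc.mul hdc).integrable_of_hasCompactSupport hv.2.deriv.mul_left
  · exact (hF'.mul hv.1.continuous).integrable_of_hasCompactSupport hv.2.mul_left
  · exact (hFc.mul hv.1.continuous).integrable_of_hasCompactSupport hv.2.mul_left

end IsClock

/-! ### The weak equation in the phase variable. -/

theorem memL2Loc_of_continuous {f : ℝ → ℝ} (hf : Continuous f) : MemL2Loc f := fun K hK => by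
  rw [memLp_two_iff_integrable_sq hf.aestronglyMeasurable]
  exact (hf.pow 2).continuousOn.integrableOn_compact hK

theorem MemL2Loc.locallyIntegrable {f : ℝ → ℝ} (hf : MemL2Loc f) : LocallyIntegrable f :=
  locallyIntegrable_iff.2 fun K hK =>
    haveI : IsFiniteMeasure (volume.restrict K) := ⟨by simpa using hK.measure_lt_top⟩
    (hf K hK).integrable (by norm_num)

theorem IsTestFunction.deriv {ψ : ℝ → ℝ} (hψ : IsTestFunction ψ) : IsTestFunction (deriv ψ) :=
  ⟨(contDiff_infty_iff_deriv.1 hψ.1).2, hψ.2.deriv⟩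

/-- A criterion for `F ∘ phase g` to be a traveling wave, in terms of its slope `P`
and of `R = 2 (F - c) P`, all written as functions of the phase. -/
theorem IsClock.isTravelingWave {g F F' P R R' : ℝ → ℝ} {μ c a : ℝ} (hg : IsClock g)
    (hF : ∀ θ, HasDerivAt F (F' θ) θ) (hF' : Continuous F')
    (hR : ∀ θ, HasDerivAt R (R' θ) θ) (hR' : Continuous R') (hP : Measurable P)
    (hPg : ∀ θ, P θ * g θ = F' θ) (hRP : ∀ θ, R θ * g θ = 2 * (F θ - c) * F' θ)
    (hode : ∀ θ, g θ ≠ 0 → P θ ^ 2 * g θ = (-4 * μ * F θ + a) * g θ + R' θ) :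
    IsTravelingWave μ c (F ∘ phase g) := by
  have hFc : Continuous F := continuous_iff_continuousAt.2 fun θ => (hF θ).continuousAt
  have hRc : Continuous R := continuous_iff_continuousAt.2 fun θ => (hR θ).continuousAt
  have hodeae : ∀ᵐ θ, P θ ^ 2 * g θ = (-4 * μ * F θ + a) * g θ + R' θ :=
    hg.ae_ne_zero.mono hode
  have hφ : MemL2Loc (F ∘ phase g) := memL2Loc_of_continuous (hFc.comp hg.continuous_phase)
  have hφ' : MemL2Loc (P ∘ phase g) := fun K hK => by
    rw [memLp_two_iff_integrable_sq
      (hP.comp hg.continuous_phase.measurable).aestronglyMeasurable]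
    refine (hg.integrableOn_iff _ K hK.measurableSet).2 ?_
    simp only [Function.comp_apply, hg.phase_clock]
    -- The slope may be unbounded, but the equation itself identifies `P² g` almost everywhere with
    -- a continuous function, which gives local square integrability.
    have hcont : Continuous fun θ => (-4 * μ * F θ + a) * g θ + R' θ :=
      (((hFc.const_mul _).add_const _).mul hg.continuous).add hR'
    refine (hcont.continuousOn.integrableOn_compact
      (hg.homeomorph.isCompact_preimage.2 hK)).congr_fun_ae ?_
    exact ae_restrict_of_ae (hodeae.mono fun θ h => h.symm)
  refine ⟨P ∘ phase g, hφ, hφ', ⟨hφ.locallyIntegrable, hφ'.locallyIntegrable, fun ψ hψ => ?_⟩,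
    a, fun ψ hψ => ?_⟩
  · simp only [Function.comp_apply]
    rw [hg.integral_comp_phase_mul_deriv hF hF' hψ, hg.integral_eq fun x => P (phase g x) * ψ x]
    congr 1
    refine integral_congr_ae (Eventually.of_forall fun θ => ?_)
    simp only [hg.phase_clock, ← hPg]
    ring
  · have hv := hg.isTestFunction_comp_clock hψ
    -- Two integrations by parts: the first turns `(F - c)²` into `R g`; the factor `g` then makes
    -- `ψ'` the phase derivative of `ψ ∘ clock g`, so the second puts the derivative on `R`, which
    -- is smooth even at a cusp.
    have hF2 : ∀ θ, HasDerivAt (fun θ => (F θ - c) ^ 2) (R θ * g θ) θ := fun θ => by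
      refine (((hF θ).sub_const c).pow 2).congr_deriv ?_
      rw [hRP]; push_cast; ring
    have e1 : ∫ x, (F (phase g x) - c) ^ 2 * iteratedDeriv 2 ψ x
        = ∫ θ, R' θ * ψ (clock g θ) := by
      have h1 := hg.integral_comp_phase_mul_deriv hF2 (hRc.mul hg.continuous) hψ.deriv
      have h2 := hg.integral_comp_phase_mul_deriv hR hR' hψ
      rw [hg.integral_eq] at h2
      simp only [hg.phase_clock] at h2
      rw [iteratedDeriv_succ, iteratedDeriv_one, h1, ← neg_eq_iff_eq_neg.2 h2]
      congr 1
      exact integral_congr_ae (Eventually.of_forall fun θ => by simp only; ring)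
    have i1 : Integrable fun θ => (-4 * μ * F θ + a) * ψ (clock g θ) * g θ := by
      refine Continuous.integrable_of_hasCompactSupport ?_ ?_
      · exact (((hFc.const_mul _).add_const _).mul hv.1.continuous).mul hg.continuous
      · exact (hv.2.mul_left (f := fun θ => -4 * μ * F θ + a)).mul_right (f' := g)
    have i2 : Integrable fun θ => R' θ * ψ (clock g θ) :=
      (hR'.mul hv.1.continuous).integrable_of_hasCompactSupport hv.2.mul_left
    simp only [Function.comp_apply]
    rw [e1, hg.integral_eq, hg.integral_eq fun x => (-4 * μ * F (phase g x) + a) * ψ x]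
    simp only [hg.phase_clock]
    rw [← integral_add i1 i2]
    refine integral_congr_ae (hodeae.mono fun θ h => ?_)
    simp only
    linear_combination ψ (clock g θ) * h

/-! ### Periods, dependence on parameters, translates and classical solutions. -/

/-- A profile `F ∘ phase g` has period one if `F` has period `π`. -/
theorem IsClock.periodic_comp_phase {g F : ℝ → ℝ} (hg : IsClock g)
    (hF : Function.Periodic F Real.pi) : Function.Periodic (F ∘ phase g) 1 := fun x => by
  simp only [Function.comp_apply, hg.phase_add_one, hF (phase g x)]

theorem IsClock.phase_int {g : ℝ → ℝ} (hg : IsClock g) (n : ℤ) : phase g n = n * Real.pi := by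
  induction n using Int.induction_on with
  | zero => simp [hg.phase_zero]
  | succ k ih => push_cast at ih ⊢; rw [hg.phase_add_one, ih]; ring
  | pred k ih =>
    have h := hg.phase_add_one (((-(k : ℤ) - 1 : ℤ) : ℝ))
    push_cast at ih h ⊢
    rw [sub_add_cancel, ih] at h
    linarith

theorem IsClock.sin_phase_eq_zero_iff {g : ℝ → ℝ} (hg : IsClock g) {x : ℝ} :
    Real.sin (phase g x) = 0 ↔ ∃ n : ℤ, x = n := by
  rw [Real.sin_eq_zero_iff]
  exact exists_congr fun n => by
    rw [← hg.phase_int, hg.strictMono_phase.injective.eq_iff, eq_comm]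

theorem sin_sq_periodic : Function.Periodic (fun θ => Real.sin θ ^ 2) Real.pi := fun θ => by
  simp [Real.sin_add_pi]

/-- `α - β sin² θ` in the phase `θ` has least period one. -/
theorem IsClock.least_period {g : ℝ → ℝ} (hg : IsClock g) {α β : ℝ} (hβ : β ≠ 0) (T : ℝ)
    (h0 : 0 < T) (h1 : T < 1) :
    ¬ Function.Periodic ((fun θ => α - β * Real.sin θ ^ 2) ∘ phase g) T := fun h => by
  have h2 := h 0
  simp only [zero_add, Function.comp_apply, hg.phase_zero, Real.sin_zero] at h2
  have h3 : Real.sin (phase g T) = 0 := by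
    have : β * Real.sin (phase g T) ^ 2 = 0 := by linarith
    simpa [hβ] using this
  obtain ⟨n, rfl⟩ := hg.sin_phase_eq_zero_iff.1 h3
  have a : (0 : ℤ) < n := by exact_mod_cast h0
  have b : n < (1 : ℤ) := by exact_mod_cast h1
  omega

/-- Joint continuity of the phase in a parameter. -/
theorem continuous_phase_uncurry {G : ℝ → ℝ → ℝ} {S : Set ℝ} (hG : ∀ s ∈ S, IsClock (G s))
    (hc : ∀ θ, ContinuousOn (fun s => clock (G s) θ) S) :
    ContinuousOn (fun p : ℝ × ℝ => phase (G p.1) p.2) (S ×ˢ univ) := by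
  rintro ⟨s, x⟩ ⟨hs, -⟩
  have hcl : ∀ θ, Tendsto (fun p : ℝ × ℝ => clock (G p.1) θ - p.2) (𝓝[S ×ˢ univ] (s, x))
      (𝓝 (clock (G s) θ - x)) := fun θ => by
    have h : ContinuousWithinAt ((fun s => clock (G s) θ) ∘ Prod.fst) (S ×ˢ univ) (s, x) :=
      ContinuousWithinAt.comp (t := S) (hc θ s hs) continuous_fst.continuousWithinAt
        fun p hp => hp.1
    exact h.sub continuous_snd.continuousWithinAt
  -- By monotonicity `θ < phase g x` means `clock g θ < x`, so continuity of the clock in the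
  -- parameter at each fixed `θ` suffices.
  refine tendsto_order.2 ⟨fun θ hθ => ?_, fun θ hθ => ?_⟩
  · have h : clock (G s) θ - x < 0 := by
      rw [← (hG s hs).strictMono_clock.lt_iff_lt, (hG s hs).clock_phase] at hθ
      simp only at hθ; linarith
    filter_upwards [(hcl θ).eventually_lt_const h, self_mem_nhdsWithin] with p hp hpS
    rw [← (hG _ hpS.1).strictMono_clock.lt_iff_lt, (hG _ hpS.1).clock_phase]
    linarith
  · have h : 0 < clock (G s) θ - x := by
      rw [gt_iff_lt, ← (hG s hs).strictMono_clock.lt_iff_lt, (hG s hs).clock_phase] at hθ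
      simp only at hθ; linarith
    filter_upwards [(hcl θ).eventually_const_lt h, self_mem_nhdsWithin] with p hp hpS
    rw [← (hG _ hpS.1).strictMono_clock.lt_iff_lt, (hG _ hpS.1).clock_phase]
    linarith

end MuHS

namespace MuHS

theorem IsClock.exists_sin_phase {g : ℝ → ℝ} (hg : IsClock g) (h θ : ℝ) :
    ∃ x, phase g (x + h) = θ :=
  ⟨clock g θ - h, by rw [sub_add_cancel, hg.phase_clock]⟩

/-- The extreme values of a profile `α - β sin² θ` are invariant under translation. -/
theorem coefficients_eq_of_translate {g g' : ℝ → ℝ} (hg : IsClock g) (hg' : IsClock g')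
    {α α' β β' h : ℝ} (hβ : 0 < β) (hβ' : 0 < β')
    (H : ∀ x, α' - β' * Real.sin (phase g' x) ^ 2 = α - β * Real.sin (phase g (x + h)) ^ 2) :
    α = α' ∧ β = β' := by
  have key : ∀ x, 0 ≤ β * Real.sin (phase g (x + h)) ^ 2 ∧
      β * Real.sin (phase g (x + h)) ^ 2 ≤ β ∧ 0 ≤ β' * Real.sin (phase g' x) ^ 2 ∧
      β' * Real.sin (phase g' x) ^ 2 ≤ β' := fun x =>
    ⟨by positivity, mul_le_of_le_one_right hβ.le (Real.sin_sq_le_one _), by positivity,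
      mul_le_of_le_one_right hβ'.le (Real.sin_sq_le_one _)⟩
  -- At these points each profile in turn attains its two extreme values; the bounds on the other
  -- profile there give all the inequalities needed.
  obtain ⟨x₁, h₁⟩ := hg.exists_sin_phase h 0
  obtain ⟨x₂, h₂⟩ := hg.exists_sin_phase h (Real.pi / 2)
  obtain ⟨x₃, h₃⟩ := hg'.exists_sin_phase 0 0
  obtain ⟨x₄, h₄⟩ := hg'.exists_sin_phase 0 (Real.pi / 2)
  rw [add_zero] at h₃ h₄
  have a₁ := H x₁
  have a₂ := H x₂
  have a₃ := H x₃
  have a₄ := H x₄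
  rw [h₁] at a₁
  rw [h₂] at a₂
  rw [h₃] at a₃
  rw [h₄] at a₄
  simp only [Real.sin_zero, Real.sin_pi_div_two] at a₁ a₂ a₃ a₄
  have b₁ := key x₁
  have b₂ := key x₂
  have b₃ := key x₃
  have b₄ := key x₄
  constructor <;> linarith

theorem hasDerivAt_profile (α β θ : ℝ) :
    HasDerivAt (fun θ => α - β * Real.sin θ ^ 2) (-(2 * β * (Real.sin θ * Real.cos θ))) θ := by
  refine ((((Real.hasDerivAt_sin θ).pow 2).const_mul β).const_sub α).congr_deriv ?_
  push_cast; ring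

theorem profile_periodic (α β : ℝ) :
    Function.Periodic (fun θ => α - β * Real.sin θ ^ 2) Real.pi := fun θ => by
  simp only [sin_sq_periodic θ]

/-- A smooth periodic profile that solves the second order equation gives a classical solution. -/
theorem isClassicalSolution_of_ode {φ : ℝ → ℝ} {c a : ℝ} (hφ : ContDiff ℝ ∞ φ)
    (hper : Function.Periodic φ 1)
    (hode : ∀ x, deriv φ x ^ 2 + 2 * (φ x - c) * iteratedDeriv 2 φ x = 4 * mean φ * φ x - a) :
    IsClassicalSolution (fun t x => φ (x - c * t)) := by
  have hn : ∀ n : ℕ, ∀ x, HasDerivAt (iteratedDeriv n φ) (iteratedDeriv (n + 1) φ x) x :=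
    fun n x => by
    rw [iteratedDeriv_succ]
    exact ((hφ.differentiable_iteratedDeriv n (by exact_mod_cast WithTop.coe_lt_top n)) x).hasDerivAt
  have h0 : ∀ x, HasDerivAt φ (deriv φ x) x := fun x => by simpa using hn 0 x
  have h1 : ∀ x, HasDerivAt (deriv φ) (iteratedDeriv 2 φ x) x := fun x => by simpa using hn 1 x
  refine ⟨hφ.comp (contDiff_snd.sub (contDiff_const.mul contDiff_fst)), fun t x => ?_,
    fun t x => ?_⟩
  · simp only
    rw [← hper (x - c * t)]
    ring_nf
  · have hmean : mean (fun x => φ (x - c * t)) = mean φ := by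
      simp only [mean]
      rw [intervalIntegral.integral_comp_sub_right fun x => φ x]
      have := hper.intervalIntegral_add_eq (0 - c * t) 0
      rw [zero_add] at this
      rw [← this]
      ring_nf
    have ht : deriv (fun s => iteratedDeriv 2 (fun x => φ (x - c * s)) x) t
        = -c * iteratedDeriv 3 φ (x - c * t) := by
      simp only [iteratedDeriv_comp_sub_const]
      have hin : HasDerivAt (fun s => x - c * s) (-c) t := by
        simpa using ((hasDerivAt_id t).const_mul c).const_sub x
      have hd : HasDerivAt (fun s => iteratedDeriv 2 φ (x - c * s))
          (iteratedDeriv 3 φ (x - c * t) * -c) t :=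
        HasDerivAt.comp (h₂ := iteratedDeriv 2 φ) t (hn 2 (x - c * t)) hin
      rw [hd.deriv]
      ring
    have hx : deriv (fun x => φ (x - c * t)) x = deriv φ (x - c * t) :=
      deriv_comp_sub_const _ _ _
    rw [ht, hmean, hx, iteratedDeriv_comp_sub_const, iteratedDeriv_comp_sub_const]
    simp only
    set y := x - c * t
    have hl := ((h1 y).pow 2).add ((((h0 y).sub_const c).const_mul 2).mul (hn 2 y))
    have hr := ((h0 y).const_mul (4 * mean φ)).sub_const a
    have he := hl.unique (hr.congr_of_eventuallyEq (Eventually.of_forall hode))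
    push_cast at he
    -- The traveling-wave form of the equation is half the derivative of the second order one.
    linear_combination (-1 / 2 : ℝ) * he

/-! ### Smooth waves. -/

/-- The profile of a smooth wave before normalization, as a function of the phase. -/
noncomputable def smoothShape (k θ : ℝ) : ℝ := k + (1 - k) * Real.sin θ ^ 2

noncomputable def smoothMass (k : ℝ) : ℝ := ∫ θ in (0 : ℝ)..Real.pi, √(smoothShape k θ)

noncomputable def smoothMoment (k : ℝ) : ℝ :=
  ∫ θ in (0 : ℝ)..Real.pi, smoothShape k θ * √(smoothShape k θ)

/-- In the first integral `M - φ` and `φ - m` are multiples of `sin² θ` and `cos² θ`; they cancel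
against `φ_θ²`, so `dx/dθ` is proportional to `√(c - φ)` up to sign under the root. The division
makes the spatial period one. -/
noncomputable def smoothClock (k θ : ℝ) : ℝ := √(smoothShape k θ) / smoothMass k

/-- The distance from the wave speed to the far extremum of the profile. -/
noncomputable def smoothScale (c k : ℝ) : ℝ :=
  c / (2 * smoothMass k ^ 2 + smoothMoment k / smoothMass k)

noncomputable def smoothProfile (c k : ℝ) : ℝ → ℝ :=
  (fun θ => (c - smoothScale c k * k) - smoothScale c k * (1 - k) * Real.sin θ ^ 2) ∘
    phase (smoothClock k)

theorem continuous_smoothShape : Continuous fun p : ℝ × ℝ => smoothShape p.1 p.2 := by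
  unfold smoothShape; fun_prop

theorem continuous_smoothMass : Continuous smoothMass :=
  intervalIntegral.continuous_parametric_intervalIntegral_of_continuous'
    (f := fun k θ => √(smoothShape k θ)) continuous_smoothShape.sqrt 0 Real.pi

theorem continuous_smoothMoment : Continuous smoothMoment :=
  intervalIntegral.continuous_parametric_intervalIntegral_of_continuous'
    (f := fun k θ => smoothShape k θ * √(smoothShape k θ))
    (continuous_smoothShape.mul continuous_smoothShape.sqrt) 0 Real.pi

theorem smoothShape_pos {k : ℝ} (hk : k ∈ Ioo (0 : ℝ) 1) (θ : ℝ) : 0 < smoothShape k θ :=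
  add_pos_of_pos_of_nonneg hk.1 (mul_nonneg (sub_nonneg.2 hk.2.le) (sq_nonneg _))

theorem contDiff_smoothShape (k : ℝ) : ContDiff ℝ ∞ (smoothShape k) :=
  contDiff_const.add (contDiff_const.mul (Real.contDiff_sin.pow 2))

theorem smoothMass_pos {k : ℝ} (hk : k ∈ Ioo (0 : ℝ) 1) : 0 < smoothMass k :=
  intervalIntegral.integral_pos Real.pi_pos (contDiff_smoothShape k).continuous.sqrt.continuousOn
    (fun _ _ => Real.sqrt_nonneg _)
    ⟨0, ⟨le_rfl, Real.pi_pos.le⟩, Real.sqrt_pos.2 (smoothShape_pos hk _)⟩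

theorem smoothMoment_pos {k : ℝ} (hk : k ∈ Ioo (0 : ℝ) 1) : 0 < smoothMoment k :=
  intervalIntegral.integral_pos Real.pi_pos
    ((contDiff_smoothShape k).continuous.mul
      (contDiff_smoothShape k).continuous.sqrt).continuousOn
    (fun θ _ => mul_nonneg (smoothShape_pos hk θ).le (Real.sqrt_nonneg _))
    ⟨0, ⟨le_rfl, Real.pi_pos.le⟩,
      mul_pos (smoothShape_pos hk _) (Real.sqrt_pos.2 (smoothShape_pos hk _))⟩

theorem smoothScale_denom_pos {k : ℝ} (hk : k ∈ Ioo (0 : ℝ) 1) :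
    0 < 2 * smoothMass k ^ 2 + smoothMoment k / smoothMass k := by
  have := smoothMass_pos hk
  have := smoothMoment_pos hk
  positivity

theorem smoothScale_ne_zero {c k : ℝ} (hc : c ≠ 0) (hk : k ∈ Ioo (0 : ℝ) 1) :
    smoothScale c k ≠ 0 := div_ne_zero hc (smoothScale_denom_pos hk).ne'

theorem smoothClock_pos {k : ℝ} (hk : k ∈ Ioo (0 : ℝ) 1) (θ : ℝ) : 0 < smoothClock k θ :=
  div_pos (Real.sqrt_pos.2 (smoothShape_pos hk θ)) (smoothMass_pos hk)

theorem isClock_smoothClock {k : ℝ} (hk : k ∈ Ioo (0 : ℝ) 1) : IsClock (smoothClock k) where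
  contDiff := ((contDiff_smoothShape k).sqrt fun θ => (smoothShape_pos hk θ).ne').div_const _
  nonneg θ := (smoothClock_pos hk θ).le
  countable_zeros := by
    convert countable_empty (α := ℝ) using 1
    exact eq_empty_of_forall_notMem fun θ hθ => (smoothClock_pos hk θ).ne' hθ
  periodic θ := by simp only [smoothClock, smoothShape, sin_sq_periodic θ]
  integral_eq_one := by
    simp only [smoothClock]
    rw [intervalIntegral.integral_div]
    exact div_self (smoothMass_pos hk).ne'

/-- The right side is the `μ` that the first integral demands of this clock. The mean computed
directly is `c - q B / A`, with `q` the scale, `A` the mass and `B` the moment; `smoothScale` is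
chosen so that the two agree. -/
theorem mean_smoothProfile {c k : ℝ} (hk : k ∈ Ioo (0 : ℝ) 1) :
    mean (smoothProfile c k) = 2 * smoothScale c k * smoothMass k ^ 2 := by
  have hA := smoothMass_pos hk
  have hg := isClock_smoothClock hk
  have hW := (contDiff_smoothShape k).continuous
  rw [smoothProfile, hg.mean_comp_phase (by fun_prop)]
  have e : ∀ θ, ((c - smoothScale c k * k) - smoothScale c k * (1 - k) * Real.sin θ ^ 2) *
      smoothClock k θ = c * smoothClock k θ -
        smoothScale c k / smoothMass k * (smoothShape k θ * √(smoothShape k θ)) := fun θ => by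
    simp only [smoothClock, smoothShape]; ring
  simp only [e]
  have hi : IntervalIntegrable (fun θ => smoothShape k θ * √(smoothShape k θ)) volume 0 Real.pi :=
    (hW.mul hW.sqrt).intervalIntegrable _ _
  rw [intervalIntegral.integral_sub ((hg.intervalIntegrable _ _).const_mul _) (hi.const_mul _),
    intervalIntegral.integral_const_mul, intervalIntegral.integral_const_mul, hg.integral_eq_one]
  change c * 1 - smoothScale c k / smoothMass k * smoothMoment k = _
  have h : smoothScale c k * (2 * smoothMass k ^ 2 + smoothMoment k / smoothMass k) = c :=
    div_mul_cancel₀ _ (smoothScale_denom_pos hk).ne'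
  linear_combination -h

/-- The slope of the smooth profile, as a function of the phase. -/
noncomputable def smoothSlope (c k θ : ℝ) : ℝ :=
  -(2 * smoothScale c k * (1 - k) * (Real.sin θ * Real.cos θ)) * smoothMass k /
    √(smoothShape k θ)

theorem smoothSlope_mul_clock {c k : ℝ} (hk : k ∈ Ioo (0 : ℝ) 1) (θ : ℝ) :
    smoothSlope c k θ * smoothClock k θ =
      -(2 * (smoothScale c k * (1 - k)) * (Real.sin θ * Real.cos θ)) := by
  have hA := smoothMass_pos hk
  have hr := Real.sqrt_pos.2 (smoothShape_pos hk θ)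
  simp only [smoothSlope, smoothClock]
  field_simp

/-- This is `((φ - c)²)_x` as a function of the phase. -/
noncomputable def smoothFlux (c k θ : ℝ) : ℝ :=
  4 * smoothScale c k ^ 2 * (1 - k) * smoothMass k *
    (Real.sin θ * Real.cos θ * √(smoothShape k θ))

noncomputable def smoothFluxDeriv (c k θ : ℝ) : ℝ :=
  4 * smoothScale c k ^ 2 * (1 - k) * smoothMass k *
    ((Real.cos θ ^ 2 - Real.sin θ ^ 2) * √(smoothShape k θ) +
      (1 - k) * (Real.sin θ * Real.cos θ) ^ 2 / √(smoothShape k θ))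

theorem hasDerivAt_smoothFlux {c k : ℝ} (hk : k ∈ Ioo (0 : ℝ) 1) (θ : ℝ) :
    HasDerivAt (smoothFlux c k) (smoothFluxDeriv c k θ) θ := by
  have hr := Real.sqrt_pos.2 (smoothShape_pos hk θ)
  have hW : HasDerivAt (smoothShape k) ((1 - k) * (2 * Real.sin θ * Real.cos θ)) θ := by
    refine ((((Real.hasDerivAt_sin θ).pow 2).const_mul (1 - k)).const_add k).congr_deriv ?_
    push_cast; ring
  refine ((((Real.hasDerivAt_sin θ).mul (Real.hasDerivAt_cos θ)).mul
    (hW.sqrt (smoothShape_pos hk θ).ne')).const_mul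
      (4 * smoothScale c k ^ 2 * (1 - k) * smoothMass k)).congr_deriv ?_
  simp only [smoothFluxDeriv, Pi.mul_apply]
  field_simp
  ring

theorem smoothFlux_eq {c k : ℝ} (hk : k ∈ Ioo (0 : ℝ) 1) (θ : ℝ) :
    smoothFlux c k θ = 2 * ((c - smoothScale c k * k) -
      smoothScale c k * (1 - k) * Real.sin θ ^ 2 - c) * smoothSlope c k θ := by
  have hr := Real.sqrt_pos.2 (smoothShape_pos hk θ)
  have hr2 := Real.sq_sqrt (smoothShape_pos hk θ).le
  have e : k + (1 - k) * Real.sin θ ^ 2 = √(smoothShape k θ) ^ 2 := hr2.symm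
  have e' : (c - smoothScale c k * k) - smoothScale c k * (1 - k) * Real.sin θ ^ 2 - c
      = -smoothScale c k * √(smoothShape k θ) ^ 2 := by rw [← e]; ring
  rw [e', smoothFlux, smoothSlope]
  field_simp
  ring

/-- The constant term is `a = 2μ (M + m)` with extreme values `c - q k` and `c - q`, where `q` is
the scale and `μ = 2 q A²`, `A` being the mass. -/
theorem smooth_ode {c k : ℝ} (hk : k ∈ Ioo (0 : ℝ) 1) (θ : ℝ) :
    smoothSlope c k θ ^ 2 * smoothClock k θ =
      (-4 * (2 * smoothScale c k * smoothMass k ^ 2) *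
        ((c - smoothScale c k * k) - smoothScale c k * (1 - k) * Real.sin θ ^ 2) +
        (8 * smoothScale c k * smoothMass k ^ 2 * c -
          4 * smoothScale c k ^ 2 * smoothMass k ^ 2 * (1 + k))) * smoothClock k θ +
        smoothFluxDeriv c k θ := by
  have hA := smoothMass_pos hk
  have hr := Real.sqrt_pos.2 (smoothShape_pos hk θ)
  have hr2 := Real.sq_sqrt (smoothShape_pos hk θ).le
  simp only [smoothSlope, smoothClock, smoothFluxDeriv]
  set r := √(smoothShape k θ)
  have hc2 : Real.cos θ ^ 2 = 1 - Real.sin θ ^ 2 := Real.cos_sq' θ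
  rw [smoothShape] at hr2
  field_simp
  rw [hr2, hc2]
  ring

theorem continuous_smoothFluxDeriv {c k : ℝ} (hk : k ∈ Ioo (0 : ℝ) 1) :
    Continuous (smoothFluxDeriv c k) := by
  have hr := (contDiff_smoothShape k).continuous.sqrt
  have hr0 : ∀ θ, √(smoothShape k θ) ≠ 0 := fun θ => (Real.sqrt_pos.2 (smoothShape_pos hk θ)).ne'
  unfold smoothFluxDeriv
  fun_prop (disch := assumption)

theorem isSmoothWave_smoothProfile {c k : ℝ} (hc : c ≠ 0) (hk : k ∈ Ioo (0 : ℝ) 1) :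
    IsSmoothWave c (smoothProfile c k) := by
  have hg := isClock_smoothClock hk
  have hg0 : ∀ θ, smoothClock k θ ≠ 0 := fun θ => (smoothClock_pos hk θ).ne'
  have hq := smoothScale_ne_zero hc hk
  have hk' : (1 - k) ≠ 0 := (sub_pos.2 hk.2).ne'
  have hper : Function.Periodic (smoothProfile c k) 1 :=
    hg.periodic_comp_phase (profile_periodic _ _)
  have hF := hasDerivAt_profile (c - smoothScale c k * k) (smoothScale c k * (1 - k))
  have hsm : ContDiff ℝ ∞ (smoothProfile c k) :=
    (contDiff_const.sub (contDiff_const.mul (Real.contDiff_sin.pow 2))).comp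
      (contDiff_iff_contDiffAt.2 fun x => hg.contDiffAt_phase (hg0 _))
  have hr := (contDiff_smoothShape k).continuous.sqrt
  have hr0 : ∀ θ, √(smoothShape k θ) ≠ 0 := fun θ => (Real.sqrt_pos.2 (smoothShape_pos hk θ)).ne'
  have hP : Continuous (smoothSlope c k) := by
    unfold smoothSlope
    fun_prop (disch := assumption)
  refine ⟨⟨hper, hg.least_period (mul_ne_zero hq hk'), ?_⟩, hsm,
    isClassicalSolution_of_ode (a := 8 * smoothScale c k * smoothMass k ^ 2 * c -
      4 * smoothScale c k ^ 2 * smoothMass k ^ 2 * (1 + k)) hsm hper fun x => ?_⟩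
  · rw [mean_smoothProfile hk]
    refine hg.isTravelingWave hF (by fun_prop) (fun θ => hasDerivAt_smoothFlux (c := c) hk θ)
      (continuous_smoothFluxDeriv hk) hP.measurable (smoothSlope_mul_clock hk) (fun θ => ?_)
      fun θ _ => smooth_ode hk θ
    rw [smoothFlux_eq hk, mul_assoc, smoothSlope_mul_clock hk]
  · have hd : ∀ y, HasDerivAt (smoothProfile c k) (smoothSlope c k (phase (smoothClock k) y)) y :=
      fun y => by
      refine ((hF _).comp y (hg.hasDerivAt_phase (hg0 _))).congr_deriv ?_
      rw [← smoothSlope_mul_clock hk, mul_inv_cancel_right₀ (hg0 _)]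
    have hfl : ∀ y, 2 * (smoothProfile c k y - c) * deriv (smoothProfile c k) y =
        smoothFlux c k (phase (smoothClock k) y) := fun y => by
      rw [(hd y).deriv, smoothFlux_eq hk]; rfl
    have h1 := (hasDerivAt_smoothFlux (c := c) hk _).comp x (hg.hasDerivAt_phase (hg0 _))
    have hdd : HasDerivAt (deriv (smoothProfile c k)) (iteratedDeriv 2 (smoothProfile c k) x) x := by
      rw [iteratedDeriv_succ, iteratedDeriv_one]
      exact (((contDiff_infty_iff_deriv.1 hsm).2.differentiable (by simp)) x).hasDerivAt
    have h2 := (((hsm.differentiable (by simp) x).hasDerivAt.sub_const c).const_mul 2).mul hdd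
    have h3 := h2.unique (h1.congr_of_eventuallyEq (Eventually.of_forall hfl))
    have h4 := smooth_ode (c := c) hk (phase (smoothClock k) x)
    rw [← (hd x).deriv] at h4
    have h5 : smoothProfile c k x = (c - smoothScale c k * k) - smoothScale c k * (1 - k) *
      Real.sin (phase (smoothClock k) x) ^ 2 := rfl
    rw [← h5] at h4
    rw [mean_smoothProfile hk]
    have h6 : smoothFluxDeriv c k (phase (smoothClock k) x) =
        (2 * deriv (smoothProfile c k) x * deriv (smoothProfile c k) x +
          2 * (smoothProfile c k x - c) * iteratedDeriv 2 (smoothProfile c k) x) *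
          smoothClock k (phase (smoothClock k) x) := by
      rw [h3, inv_mul_cancel_right₀ (hg0 _)]
    rw [h6] at h4
    refine mul_right_cancel₀ (hg0 (phase (smoothClock k) x)) ?_
    linear_combination -h4

theorem smoothProfile_not_translate {c k k' : ℝ} (hc : c ≠ 0) (hk : k ∈ Ioo (0 : ℝ) 1)
    (hk' : k' ∈ Ioo (0 : ℝ) 1) (hne : k ≠ k') :
    ¬ ∃ h : ℝ, ∀ x, smoothProfile c k' x = smoothProfile c k (x + h) := by
  rintro ⟨h, H⟩
  have hg := isClock_smoothClock hk
  have hg' := isClock_smoothClock hk'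
  have hp := sub_pos.2 hk.2
  have hp' := sub_pos.2 hk'.2
  simp only [smoothProfile, Function.comp_apply] at H
  have key : c - smoothScale c k * k = c - smoothScale c k' * k' ∧
      smoothScale c k * (1 - k) = smoothScale c k' * (1 - k') := by
    -- The scale has the sign of `c`; when it is negative the extrema change roles, and the
    -- comparison is applied to the negated profiles.
    rcases hc.lt_or_gt with hc | hc
    · have hq := div_neg_of_neg_of_pos hc (smoothScale_denom_pos hk)
      have hq' := div_neg_of_neg_of_pos hc (smoothScale_denom_pos hk')
      obtain ⟨h1, h2⟩ := coefficients_eq_of_translate (α := -(c - smoothScale c k * k))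
        (β := -smoothScale c k * (1 - k)) (α' := -(c - smoothScale c k' * k'))
        (β' := -smoothScale c k' * (1 - k')) hg hg' (mul_pos (neg_pos.2 hq) hp)
        (mul_pos (neg_pos.2 hq') hp') fun x => by linear_combination -H x
      constructor <;> linarith
    · exact coefficients_eq_of_translate hg hg' (mul_pos (div_pos hc (smoothScale_denom_pos hk)) hp)
        (mul_pos (div_pos hc (smoothScale_denom_pos hk')) hp') H
  -- One extreme value is `c` minus the scale, so the extrema determine the scale first and then
  -- `k`.
  have hq : smoothScale c k = smoothScale c k' := by linarith [key.1, key.2]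
  have h1 := key.1
  rw [← hq] at h1
  exact hne (mul_left_cancel₀ (smoothScale_ne_zero hc hk) (by linarith))

theorem exists_smooth_family {c : ℝ} (hc : c ≠ 0) :
    IsOneParameterFamily (IsSmoothWave c) (smoothProfile c) := by
  refine ⟨fun k hk => isSmoothWave_smoothProfile hc hk, ?_,
    fun k hk k' hk' hne => smoothProfile_not_translate hc hk hk' hne⟩
  have hq : ContinuousOn (smoothScale c) (Ioo 0 1) :=
    continuousOn_const.div ((continuous_const.mul (continuous_smoothMass.pow 2)).continuousOn.add
      (continuous_smoothMoment.continuousOn.div continuous_smoothMass.continuousOn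
        fun k hk => (smoothMass_pos hk).ne')) fun k hk => (smoothScale_denom_pos hk).ne'
  have hq' : ContinuousOn (fun p : ℝ × ℝ => smoothScale c p.1) (Ioo 0 1 ×ˢ univ) :=
    hq.comp continuousOn_fst fun p hp => hp.1
  have hφ : ContinuousOn (fun p : ℝ × ℝ => phase (smoothClock p.1) p.2) (Ioo 0 1 ×ˢ univ) := by
    refine continuous_phase_uncurry (fun k hk => isClock_smoothClock hk) fun θ => ?_
    simp only [clock, smoothClock, intervalIntegral.integral_div]
    exact (intervalIntegral.continuous_parametric_intervalIntegral_of_continuous'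
      (f := fun k θ => √(smoothShape k θ)) continuous_smoothShape.sqrt 0 θ).continuousOn.div
        continuous_smoothMass.continuousOn fun k hk => (smoothMass_pos hk).ne'
  simp only [smoothProfile, Function.comp_apply]
  fun_prop

end MuHS

namespace MuHS

/-! ### Cusped waves. -/

/-- Up to normalization, the density of the phase along a cusped wave. -/
noncomputable def cuspDensity (s θ : ℝ) : ℝ := Real.sin θ ^ 2 / √(1 + s * Real.sin θ ^ 2)

noncomputable def cuspMass (s : ℝ) : ℝ := ∫ θ in (0 : ℝ)..Real.pi, cuspDensity s θ

noncomputable def cuspMoment (s : ℝ) : ℝ :=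
  ∫ θ in (0 : ℝ)..Real.pi, Real.sin θ ^ 2 * cuspDensity s θ

noncomputable def cuspClock (s θ : ℝ) : ℝ := cuspDensity s θ / cuspMass s

/-- The first integral demands `μ = 2 q s I²` and the direct mean is `c - q J / I`, with `q` the
scale, `I` the mass and `J` the moment. Equating them gives `q * cuspDenom s = c`. -/
noncomputable def cuspDenom (s : ℝ) : ℝ := 2 * s * cuspMass s ^ 2 + cuspMoment s / cuspMass s

/-- The amplitude of the cusped wave of speed `c`. -/
noncomputable def cuspScale (c s : ℝ) : ℝ := c / cuspDenom s

noncomputable def cuspProfile (c s : ℝ) : ℝ → ℝ :=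
  (fun θ => c - cuspScale c s * Real.sin θ ^ 2) ∘ phase (cuspClock s)

theorem one_add_mul_sin_sq_pos {s : ℝ} (hs : -1 < s) (θ : ℝ) : 0 < 1 + s * Real.sin θ ^ 2 := by
  rcases (sq_nonneg (Real.sin θ)).eq_or_lt with h | h
  · simp [← h]
  · linarith [Real.sin_sq_le_one θ, mul_pos (by linarith : 0 < s + 1) h]

/-- The reparametrization `S` keeps the parameter above `-1` on the whole line, so that parametric
integrals can be handled by global continuity. -/
theorem continuous_cuspDensity {S : ℝ → ℝ} (hS : Continuous S) (hS1 : ∀ s, -1 < S s) :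
    Continuous fun p : ℝ × ℝ => cuspDensity (S p.1) p.2 := by
  have h0 : ∀ p : ℝ × ℝ, √(1 + S p.1 * Real.sin p.2 ^ 2) ≠ 0 := fun p =>
    (Real.sqrt_pos.2 (one_add_mul_sin_sq_pos (hS1 _) _)).ne'
  unfold cuspDensity
  fun_prop (disch := assumption)

section

variable {s : ℝ}

theorem contDiff_cuspDensity (hs : -1 < s) : ContDiff ℝ ∞ (cuspDensity s) :=
  (Real.contDiff_sin.pow 2).div
    ((contDiff_const.add (contDiff_const.mul (Real.contDiff_sin.pow 2))).sqrt
      fun θ => (one_add_mul_sin_sq_pos hs θ).ne')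
    fun θ => (Real.sqrt_pos.2 (one_add_mul_sin_sq_pos hs θ)).ne'

theorem cuspDensity_nonneg (s θ : ℝ) : 0 ≤ cuspDensity s θ := by
  unfold cuspDensity; positivity

theorem cuspDensity_eq_zero_iff (hs : -1 < s) {θ : ℝ} : cuspDensity s θ = 0 ↔ Real.sin θ = 0 := by
  simp [cuspDensity, (Real.sqrt_pos.2 (one_add_mul_sin_sq_pos hs θ)).ne']

theorem cuspMass_pos (hs : -1 < s) : 0 < cuspMass s :=
  intervalIntegral.integral_pos Real.pi_pos (contDiff_cuspDensity hs).continuous.continuousOn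
    (fun _ _ => cuspDensity_nonneg _ _)
    ⟨Real.pi / 2, ⟨by positivity, by linarith [Real.pi_pos]⟩,
      (cuspDensity_nonneg _ _).lt_of_ne' ((cuspDensity_eq_zero_iff hs).not.2 (by simp))⟩

theorem cuspMoment_pos (hs : -1 < s) : 0 < cuspMoment s := by
  have hc := (contDiff_cuspDensity hs).continuous
  refine intervalIntegral.integral_pos Real.pi_pos (by fun_prop)
    (fun _ _ => mul_nonneg (sq_nonneg _) (cuspDensity_nonneg _ _))
    ⟨Real.pi / 2, ⟨by positivity, by linarith [Real.pi_pos]⟩, ?_⟩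
  rw [Real.sin_pi_div_two, one_pow, one_mul]
  exact (cuspDensity_nonneg _ _).lt_of_ne' ((cuspDensity_eq_zero_iff hs).not.2 (by simp))

theorem isClock_cuspClock (hs : -1 < s) : IsClock (cuspClock s) where
  contDiff := (contDiff_cuspDensity hs).div_const _
  nonneg θ := div_nonneg (cuspDensity_nonneg _ _) (cuspMass_pos hs).le
  countable_zeros := by
    refine (countable_range fun n : ℤ => n * Real.pi).mono fun θ hθ => ?_
    rw [mem_ofPred_eq, cuspClock, div_eq_zero_iff, or_iff_left (cuspMass_pos hs).ne',
      cuspDensity_eq_zero_iff hs] at hθ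
    exact Real.sin_eq_zero_iff.1 hθ
  periodic θ := by simp only [cuspClock, cuspDensity, sin_sq_periodic θ]
  integral_eq_one := by
    simp only [cuspClock]
    rw [intervalIntegral.integral_div]
    exact div_self (cuspMass_pos hs).ne'

theorem cuspClock_ne_zero_iff (hs : -1 < s) {θ : ℝ} : cuspClock s θ ≠ 0 ↔ Real.sin θ ≠ 0 := by
  rw [cuspClock, Ne, div_eq_zero_iff, or_iff_left (cuspMass_pos hs).ne',
    cuspDensity_eq_zero_iff hs]

variable {c : ℝ}

theorem mean_cuspProfile (hs : -1 < s) (hd : cuspDenom s ≠ 0) :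
    mean (cuspProfile c s) = 2 * cuspScale c s * s * cuspMass s ^ 2 := by
  have hg := isClock_cuspClock hs
  have hD := (contDiff_cuspDensity hs).continuous
  rw [cuspProfile, hg.mean_comp_phase (by fun_prop)]
  have e : ∀ θ, (c - cuspScale c s * Real.sin θ ^ 2) * cuspClock s θ = c * cuspClock s θ -
      cuspScale c s / cuspMass s * (Real.sin θ ^ 2 * cuspDensity s θ) := fun θ => by
    simp only [cuspClock]; ring
  simp only [e]
  have hi : IntervalIntegrable (fun θ => Real.sin θ ^ 2 * cuspDensity s θ) volume 0 Real.pi :=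
    Continuous.intervalIntegrable (by fun_prop) _ _
  rw [intervalIntegral.integral_sub ((hg.intervalIntegrable _ _).const_mul _) (hi.const_mul _),
    intervalIntegral.integral_const_mul, intervalIntegral.integral_const_mul, hg.integral_eq_one]
  change c * 1 - cuspScale c s / cuspMass s * cuspMoment s = _
  have h : cuspScale c s * cuspDenom s = c := div_mul_cancel₀ _ hd
  rw [cuspDenom] at h
  linear_combination -h

/-- The slope of the cusped profile, as a function of the phase. -/
noncomputable def cuspSlope (c s θ : ℝ) : ℝ :=
  -(2 * cuspScale c s * cuspMass s) * √(1 + s * Real.sin θ ^ 2) * Real.cos θ * (Real.sin θ)⁻¹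

noncomputable def cuspFlux (c s θ : ℝ) : ℝ :=
  4 * cuspScale c s ^ 2 * cuspMass s *
    (Real.sin θ * Real.cos θ * √(1 + s * Real.sin θ ^ 2))

noncomputable def cuspFluxDeriv (c s θ : ℝ) : ℝ :=
  4 * cuspScale c s ^ 2 * cuspMass s *
    ((Real.cos θ ^ 2 - Real.sin θ ^ 2) * √(1 + s * Real.sin θ ^ 2) +
      s * (Real.sin θ * Real.cos θ) ^ 2 / √(1 + s * Real.sin θ ^ 2))

theorem cuspSlope_mul_clock (hs : -1 < s) (θ : ℝ) :
    cuspSlope c s θ * cuspClock s θ = -(2 * cuspScale c s * (Real.sin θ * Real.cos θ)) := by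
  have hI := cuspMass_pos hs
  have hr := Real.sqrt_pos.2 (one_add_mul_sin_sq_pos hs θ)
  simp only [cuspSlope, cuspClock, cuspDensity]
  -- At a cusp the inverse of `sin θ` is `0` by convention, and both sides vanish.
  rcases eq_or_ne (Real.sin θ) 0 with h0 | h0
  · simp [h0]
  · field_simp

theorem cuspFlux_mul_clock (hs : -1 < s) (θ : ℝ) :
    cuspFlux c s θ * cuspClock s θ = 2 * ((c - cuspScale c s * Real.sin θ ^ 2) - c) *
      -(2 * cuspScale c s * (Real.sin θ * Real.cos θ)) := by
  have hI := cuspMass_pos hs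
  have hr := Real.sqrt_pos.2 (one_add_mul_sin_sq_pos hs θ)
  simp only [cuspFlux, cuspClock, cuspDensity]
  set r := √(1 + s * Real.sin θ ^ 2)
  field_simp
  ring

theorem hasDerivAt_cuspFlux (hs : -1 < s) (θ : ℝ) :
    HasDerivAt (cuspFlux c s) (cuspFluxDeriv c s θ) θ := by
  have hr := Real.sqrt_pos.2 (one_add_mul_sin_sq_pos hs θ)
  have hW : HasDerivAt (fun θ => 1 + s * Real.sin θ ^ 2) (s * (2 * Real.sin θ * Real.cos θ)) θ := by
    refine ((((Real.hasDerivAt_sin θ).pow 2).const_mul s).const_add 1).congr_deriv ?_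
    push_cast; ring
  refine ((((Real.hasDerivAt_sin θ).mul (Real.hasDerivAt_cos θ)).mul
    (hW.sqrt (one_add_mul_sin_sq_pos hs θ).ne')).const_mul
      (4 * cuspScale c s ^ 2 * cuspMass s)).congr_deriv ?_
  simp only [cuspFluxDeriv, Pi.mul_apply]
  field_simp
  ring

theorem continuous_cuspFluxDeriv (hs : -1 < s) : Continuous (cuspFluxDeriv c s) := by
  have h0 : ∀ θ, √(1 + s * Real.sin θ ^ 2) ≠ 0 := fun θ =>
    (Real.sqrt_pos.2 (one_add_mul_sin_sq_pos hs θ)).ne'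
  unfold cuspFluxDeriv
  fun_prop (disch := assumption)

/-- Again `a = 2μ (M + m)` when `s ≠ 0`; the roots of the first integral are now the minimum `c - q`
and the unattained value `c + q / s`. -/
theorem cusp_ode (hs : -1 < s) {θ : ℝ} (hθ : Real.sin θ ≠ 0) :
    cuspSlope c s θ ^ 2 * cuspClock s θ =
      (-4 * (2 * cuspScale c s * s * cuspMass s ^ 2) * (c - cuspScale c s * Real.sin θ ^ 2) +
        (8 * cuspScale c s * s * cuspMass s ^ 2 * c +
          4 * cuspScale c s ^ 2 * cuspMass s ^ 2 * (1 - s))) * cuspClock s θ +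
        cuspFluxDeriv c s θ := by
  have hI := cuspMass_pos hs
  have hr := Real.sqrt_pos.2 (one_add_mul_sin_sq_pos hs θ)
  have hr2 := Real.sq_sqrt (one_add_mul_sin_sq_pos hs θ).le
  have hc2 : Real.cos θ ^ 2 = 1 - Real.sin θ ^ 2 := Real.cos_sq' θ
  simp only [cuspSlope, cuspClock, cuspDensity, cuspFluxDeriv]
  set r := √(1 + s * Real.sin θ ^ 2)
  field_simp
  rw [hr2, hc2]
  ring

theorem cuspProfile_eq_iff (hs : -1 < s) (hq : 0 < cuspScale c s) {x : ℝ} :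
    cuspProfile c s x = c ↔ ∃ n : ℤ, x = n := by
  rw [← (isClock_cuspClock hs).sin_phase_eq_zero_iff]
  simp [cuspProfile, hq.ne']

theorem sin_phase_ne_zero (hs : -1 < s) (hq : 0 < cuspScale c s) {x : ℝ}
    (hx : cuspProfile c s x ≠ c) : Real.sin (phase (cuspClock s) x) ≠ 0 := by
  rwa [Ne, (isClock_cuspClock hs).sin_phase_eq_zero_iff, ← cuspProfile_eq_iff hs hq]

theorem contDiffOn_cuspProfile (hs : -1 < s) (hq : 0 < cuspScale c s) :
    ContDiffOn ℝ ∞ (cuspProfile c s) {x | cuspProfile c s x ≠ c} := fun x hx => by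
  have h : ContDiff ℝ ∞ fun θ => c - cuspScale c s * Real.sin θ ^ 2 :=
    contDiff_const.sub (contDiff_const.mul (Real.contDiff_sin.pow 2))
  exact (h.contDiffAt.comp x ((isClock_cuspClock hs).contDiffAt_phase
    ((cuspClock_ne_zero_iff hs).2 (sin_phase_ne_zero hs hq hx)))).contDiffWithinAt

theorem deriv_cuspProfile (hs : -1 < s) {x : ℝ} (hx : Real.sin (phase (cuspClock s) x) ≠ 0) :
    deriv (cuspProfile c s) x = cuspSlope c s (phase (cuspClock s) x) := by
  have hg0 := (cuspClock_ne_zero_iff hs).2 hx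
  refine (((hasDerivAt_profile c (cuspScale c s) _).comp x
    ((isClock_cuspClock hs).hasDerivAt_phase hg0)).congr_deriv ?_).deriv
  rw [← cuspSlope_mul_clock hs, mul_inv_cancel_right₀ hg0]

theorem cuspSlope_periodic (c s : ℝ) : Function.Periodic (cuspSlope c s) Real.pi := fun θ => by
  simp only [cuspSlope, Real.sin_add_pi, Real.cos_add_pi, inv_neg, neg_sq, mul_neg]
  simp

/-- The slope is this bounded factor, negative near `0` when the scale is positive, times `1 / sin
θ`, which produces the blow-up and its signs. -/
theorem tendsto_cuspSlope_coefficient (c s : ℝ) :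
    Tendsto (fun θ => -(2 * cuspScale c s * cuspMass s) * √(1 + s * Real.sin θ ^ 2) * Real.cos θ)
      (𝓝 0) (𝓝 (-(2 * cuspScale c s * cuspMass s))) := by
  have h : Continuous fun θ =>
      -(2 * cuspScale c s * cuspMass s) * √(1 + s * Real.sin θ ^ 2) * Real.cos θ := by fun_prop
  simpa using h.tendsto 0

theorem tendsto_cuspSlope_left (hs : -1 < s) (hq : 0 < cuspScale c s) :
    Tendsto (cuspSlope c s) (𝓝[<] 0) atTop := by
  have hsin : Tendsto Real.sin (𝓝[<] 0) (𝓝[<] 0) := by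
    refine tendsto_nhdsWithin_iff.2 ⟨?_, ?_⟩
    · simpa using (Real.continuous_sin.tendsto 0).mono_left nhdsWithin_le_nhds
    · filter_upwards [Ioo_mem_nhdsLT (neg_neg_of_pos Real.pi_pos)] with θ hθ
      exact Real.sin_neg_of_neg_of_neg_pi_lt hθ.2 hθ.1
  have hpos : -(2 * cuspScale c s * cuspMass s) < 0 := by
    have := cuspMass_pos hs
    linarith [mul_pos (mul_pos two_pos hq) this]
  exact ((tendsto_cuspSlope_coefficient c s).mono_left nhdsWithin_le_nhds).neg_mul_atBot hpos
    (tendsto_inv_nhdsLT_zero.comp hsin)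

theorem tendsto_cuspSlope_right (hs : -1 < s) (hq : 0 < cuspScale c s) :
    Tendsto (cuspSlope c s) (𝓝[>] 0) atBot := by
  have hsin : Tendsto Real.sin (𝓝[>] 0) (𝓝[>] 0) := by
    refine tendsto_nhdsWithin_iff.2 ⟨?_, ?_⟩
    · simpa using (Real.continuous_sin.tendsto 0).mono_left nhdsWithin_le_nhds
    · filter_upwards [Ioo_mem_nhdsGT Real.pi_pos] with θ hθ
      exact Real.sin_pos_of_pos_of_lt_pi hθ.1 hθ.2
  have hpos : -(2 * cuspScale c s * cuspMass s) < 0 := by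
    have := cuspMass_pos hs
    linarith [mul_pos (mul_pos two_pos hq) this]
  exact ((tendsto_cuspSlope_coefficient c s).mono_left nhdsWithin_le_nhds).neg_mul_atTop hpos
    (tendsto_inv_nhdsGT_zero.comp hsin)

theorem hasCuspAt_cuspProfile (hs : -1 < s) (hq : 0 < cuspScale c s) (n : ℤ) :
    HasCuspAt (cuspProfile c s) n := by
  have hg := isClock_cuspClock hs
  have hcont : Continuous (cuspProfile c s) :=
    Continuous.comp (by fun_prop) hg.continuous_phase
  have hne : ∀ m : ℤ, ∀ x ∈ Ioo (m : ℝ) (m + 1), cuspProfile c s x ≠ c := fun m x hx h => by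
    obtain ⟨k, rfl⟩ := (cuspProfile_eq_iff hs hq).1 h
    have h1 : m < k := by exact_mod_cast hx.1
    have h2 : k < m + 1 := by exact_mod_cast hx.2
    omega
  have hneL : ∀ x ∈ Ioo ((n : ℝ) - 1) n, cuspProfile c s x ≠ c := fun x hx =>
    hne (n - 1) x (by push_cast; simpa using hx)
  -- The slope is `π`-periodic in the phase, so every cusp reduces to the one at phase `0`.
  have hslope : ∀ x, cuspSlope c s (phase (cuspClock s) x) =
      cuspSlope c s (phase (cuspClock s) x - n * Real.pi) := fun x =>
    ((cuspSlope_periodic c s).sub_int_mul_eq n).symm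
  have hshift : Tendsto (fun x => phase (cuspClock s) x - n * Real.pi) (𝓝 n) (𝓝 0) := by
    have h : Continuous fun x => phase (cuspClock s) x - n * Real.pi :=
      hg.continuous_phase.sub continuous_const
    simpa [hg.phase_int] using h.tendsto n
  refine ⟨hcont.continuousAt, ⟨1, one_pos, (contDiffOn_cuspProfile hs hq).mono hneL,
    (contDiffOn_cuspProfile hs hq).mono (hne n)⟩, ?_, ?_⟩
  · have ht : Tendsto (fun x => phase (cuspClock s) x - n * Real.pi) (𝓝[<] (n : ℝ)) (𝓝[<] 0) := by
      refine tendsto_nhdsWithin_iff.2 ⟨hshift.mono_left nhdsWithin_le_nhds, ?_⟩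
      filter_upwards [self_mem_nhdsWithin] with x hx
      rw [mem_Iio, sub_neg, ← hg.phase_int]
      exact hg.strictMono_phase hx
    refine ((tendsto_cuspSlope_left hs hq).comp ht).congr' ?_
    filter_upwards [Ioo_mem_nhdsLT (sub_one_lt (n : ℝ))] with x hx
    rw [deriv_cuspProfile hs (sin_phase_ne_zero hs hq (hneL x hx)), hslope]
    rfl
  · have ht : Tendsto (fun x => phase (cuspClock s) x - n * Real.pi) (𝓝[>] (n : ℝ)) (𝓝[>] 0) := by
      refine tendsto_nhdsWithin_iff.2 ⟨hshift.mono_left nhdsWithin_le_nhds, ?_⟩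
      filter_upwards [self_mem_nhdsWithin] with x hx
      rw [mem_Ioi, sub_pos, ← hg.phase_int]
      exact hg.strictMono_phase hx
    refine ((tendsto_cuspSlope_right hs hq).comp ht).congr' ?_
    filter_upwards [Ioo_mem_nhdsGT (lt_add_one (n : ℝ))] with x hx
    rw [deriv_cuspProfile hs (sin_phase_ne_zero hs hq (hne n x hx)), hslope]
    rfl

theorem isCuspedWave_cuspProfile (hs : -1 < s) (hq : 0 < cuspScale c s) :
    IsCuspedWave c (cuspProfile c s) := by
  have hg := isClock_cuspClock hs
  have hd : cuspDenom s ≠ 0 := fun h => by simp [cuspScale, h] at hq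
  have hP : Measurable (cuspSlope c s) := by unfold cuspSlope; fun_prop
  refine ⟨⟨hg.periodic_comp_phase (profile_periodic _ _), hg.least_period hq.ne', ?_⟩, fun x => ?_,
    ⟨0, fun x => by simpa using cuspProfile_eq_iff hs hq⟩, fun x hx => ?_,
    contDiffOn_cuspProfile hs hq⟩
  · rw [mean_cuspProfile hs hd]
    exact hg.isTravelingWave (hasDerivAt_profile c (cuspScale c s)) (by fun_prop)
      (hasDerivAt_cuspFlux hs) (continuous_cuspFluxDeriv hs) hP (cuspSlope_mul_clock hs)
      (cuspFlux_mul_clock hs) fun θ hθ => cusp_ode hs ((cuspClock_ne_zero_iff hs).1 hθ)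
  · exact sub_le_self _ (mul_nonneg hq.le (sq_nonneg _))
  · obtain ⟨n, rfl⟩ := (cuspProfile_eq_iff hs hq).1 hx
    exact hasCuspAt_cuspProfile hs hq n

/-- The first integral: the squared slope depends only on `sin² θ`, that is, on the height, so it
can be compared between translates without knowing the phase. -/
theorem cuspSlope_sq {θ : ℝ} (hs : -1 < s) (hθ : Real.sin θ ≠ 0) :
    cuspSlope c s θ ^ 2 * Real.sin θ ^ 2 = 4 * cuspScale c s ^ 2 * cuspMass s ^ 2 *
      (1 + s * Real.sin θ ^ 2) * (1 - Real.sin θ ^ 2) := by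
  have hr2 := Real.sq_sqrt (one_add_mul_sin_sq_pos hs θ).le
  rw [← Real.cos_sq', ← hr2, cuspSlope]
  set r := √(1 + s * Real.sin θ ^ 2)
  field_simp
  ring

/-- The parameter of a cusped wave is determined by its profile up to translation. -/
theorem eq_of_cuspProfile_translate {s' : ℝ} (hs : -1 < s) (hs' : -1 < s')
    (hq : 0 < cuspScale c s) (hq' : 0 < cuspScale c s') {h : ℝ}
    (H : ∀ x, cuspProfile c s' x = cuspProfile c s (x + h)) : s = s' := by
  have hg := isClock_cuspClock hs
  have hg' := isClock_cuspClock hs'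
  have hqq : cuspScale c s = cuspScale c s' := (coefficients_eq_of_translate hg hg' hq hq' H).2
  have hder : ∀ x, deriv (cuspProfile c s') x = deriv (cuspProfile c s) (x + h) := fun x => by
    rw [funext H, deriv_comp_add_const]
  have key : ∀ θ, Real.sin θ ≠ 0 → Real.sin θ ^ 2 ≠ 1 → cuspMass s' ^ 2 * (1 + s' * Real.sin θ ^ 2)
      = cuspMass s ^ 2 * (1 + s * Real.sin θ ^ 2) := fun θ hθ hθ1 => by
    obtain ⟨x, hx⟩ := hg'.surjective_phase θ
    have hsin : Real.sin (phase (cuspClock s) (x + h)) ^ 2 = Real.sin θ ^ 2 := by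
      have := H x
      simp only [cuspProfile, Function.comp_apply, hx, hqq] at this
      exact (mul_left_cancel₀ hq'.ne' (by linarith)).symm
    have hθ2 : Real.sin (phase (cuspClock s) (x + h)) ≠ 0 := fun h0 => by
      rw [h0] at hsin
      exact hθ (pow_eq_zero_iff two_ne_zero |>.1 (by rw [← hsin]; simp))
    have hd := hder x
    rw [deriv_cuspProfile hs hθ2, deriv_cuspProfile hs' (by rwa [hx]), hx] at hd
    have e := cuspSlope_sq (c := c) hs hθ2
    rw [← hd, hsin, cuspSlope_sq hs' hθ, hqq] at e
    have hne : 4 * cuspScale c s' ^ 2 * (1 - Real.sin θ ^ 2) ≠ 0 :=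
      mul_ne_zero (by positivity) (sub_ne_zero.2 hθ1.symm)
    exact mul_left_cancel₀ hne (by linear_combination e)
  -- The key identity is affine in `sin² θ`; two values of it determine the squared mass and then
  -- the parameter.
  have s4 : Real.sin (Real.pi / 4) ^ 2 = 1 / 2 := by
    rw [Real.sin_pi_div_four, div_pow, Real.sq_sqrt] <;> norm_num
  have s3 : Real.sin (Real.pi / 3) ^ 2 = 3 / 4 := by
    rw [Real.sin_pi_div_three, div_pow, Real.sq_sqrt] <;> norm_num
  have k4 := key (Real.pi / 4) (fun h0 => by norm_num [h0] at s4) (by rw [s4]; norm_num)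
  have k3 := key (Real.pi / 3) (fun h0 => by norm_num [h0] at s3) (by rw [s3]; norm_num)
  rw [s4] at k4
  rw [s3] at k3
  have m : cuspMass s' ^ 2 = cuspMass s ^ 2 := by linarith
  rw [m] at k3 k4
  exact mul_left_cancel₀ (pow_pos (cuspMass_pos hs) 2).ne' (by linarith)

end

/-! ### Families of cusped waves and the sign of the speed. -/

theorem isOneParameterFamily_cuspProfile {c : ℝ} {S : ℝ → ℝ} (hS : Continuous S)
    (hS1 : ∀ s, -1 < S s) (hinj : InjOn S (Ioo 0 1)) (hq : ∀ s, 0 < s → 0 < cuspScale c (S s)) :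
    IsOneParameterFamily (IsCuspedWave c) fun s => cuspProfile c (S s) := by
  refine ⟨fun s hs => isCuspedWave_cuspProfile (hS1 s) (hq s hs.1), ?_,
    fun s hs s' hs' hne ⟨h, H⟩ => hne (hinj hs hs'
      (eq_of_cuspProfile_translate (hS1 s) (hS1 s') (hq s hs.1) (hq s' hs'.1) H))⟩
  have hD := continuous_cuspDensity hS hS1
  have hmass : Continuous fun s => cuspMass (S s) :=
    intervalIntegral.continuous_parametric_intervalIntegral_of_continuous'
      (f := fun s θ => cuspDensity (S s) θ) hD 0 Real.pi
  have hD2 : Continuous fun p : ℝ × ℝ => Real.sin p.2 ^ 2 * cuspDensity (S p.1) p.2 := by fun_prop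
  have hmoment : Continuous fun s => cuspMoment (S s) :=
    intervalIntegral.continuous_parametric_intervalIntegral_of_continuous'
      (f := fun s θ => Real.sin θ ^ 2 * cuspDensity (S s) θ) hD2 0 Real.pi
  have hden : Continuous fun s => cuspDenom (S s) :=
    ((continuous_const.mul hS).mul (hmass.pow 2)).add
      (hmoment.div hmass fun s => (cuspMass_pos (hS1 s)).ne')
  have hsc : ContinuousOn (fun s => cuspScale c (S s)) (Ioo 0 1) :=
    continuousOn_const.div hden.continuousOn fun s hs h0 => by
      simpa [cuspScale, h0] using hq s hs.1
  have hsc' : ContinuousOn (fun p : ℝ × ℝ => cuspScale c (S p.1)) (Ioo 0 1 ×ˢ univ) :=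
    hsc.comp continuousOn_fst fun p hp => hp.1
  have hφ : ContinuousOn (fun p : ℝ × ℝ => phase (cuspClock (S p.1)) p.2) (Ioo 0 1 ×ˢ univ) := by
    refine continuous_phase_uncurry (G := fun s => cuspClock (S s))
      (fun s _ => isClock_cuspClock (hS1 s)) fun θ => ?_
    simp only [clock, cuspClock, intervalIntegral.integral_div]
    exact ((intervalIntegral.continuous_parametric_intervalIntegral_of_continuous'
      (f := fun s θ => cuspDensity (S s) θ) hD 0 θ).div hmass
        fun s => (cuspMass_pos (hS1 s)).ne').continuousOn
  simp only [cuspProfile, Function.comp_apply]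
  fun_prop

theorem cuspDenom_pos {s : ℝ} (hs : 0 ≤ s) : 0 < cuspDenom s := by
  have h1 := cuspMass_pos (s := s) (by linarith)
  have h2 := cuspMoment_pos (s := s) (by linarith)
  unfold cuspDenom
  positivity

theorem cuspMoment_le_cuspMass {s : ℝ} (hs : -1 < s) : cuspMoment s ≤ cuspMass s := by
  have hc := (contDiff_cuspDensity hs).continuous
  refine intervalIntegral.integral_mono_on Real.pi_pos.le
    (Continuous.intervalIntegrable (by fun_prop) _ _) (hc.intervalIntegrable _ _) fun θ _ => ?_
  exact mul_le_of_le_one_left (cuspDensity_nonneg _ _) (Real.sin_sq_le_one _)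

theorem pi_div_two_le_cuspMass {s : ℝ} (hs : -1 < s) (hs0 : s ≤ 0) :
    Real.pi / 2 ≤ cuspMass s := by
  have hc := (contDiff_cuspDensity hs).continuous
  have h : ∫ θ in (0 : ℝ)..Real.pi, Real.sin θ ^ 2 = Real.pi / 2 := by
    rw [integral_sin_sq]; simp
  rw [← h]
  refine intervalIntegral.integral_mono_on Real.pi_pos.le
    (Continuous.intervalIntegrable (by fun_prop) _ _) (hc.intervalIntegrable _ _) fun θ _ => ?_
  refine le_div_self (sq_nonneg _) (Real.sqrt_pos.2 (one_add_mul_sin_sq_pos hs θ)) ?_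
  rw [Real.sqrt_le_one]
  linarith [mul_nonneg (neg_nonneg.2 hs0) (sq_nonneg (Real.sin θ))]

/-- Since the mass exceeds `3/2`, the first term is at most minus its square, below `-9/4`, while
the quotient of moment and mass is at most `1`. -/
theorem cuspDenom_neg {s : ℝ} (hs : -1 < s) (hs2 : s ≤ -1 / 2) : cuspDenom s < 0 := by
  have h1 := cuspMass_pos hs
  have h2 : cuspMoment s / cuspMass s ≤ 1 := (div_le_one h1).2 (cuspMoment_le_cuspMass hs)
  have h3 : 3 / 2 < cuspMass s := by
    linarith [pi_div_two_le_cuspMass hs (by linarith), Real.pi_gt_three]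
  unfold cuspDenom
  nlinarith

theorem exists_cusped_family {c : ℝ} (hc : c ≠ 0) :
    ∃ Φ : ℝ → ℝ → ℝ, IsOneParameterFamily (IsCuspedWave c) Φ := by
  rcases hc.lt_or_gt with hc | hc
  -- The parameter `-1 + 1 / (2 + s²)` stays in `(-1, -1/2]` for all real `s` and is injective for
  -- `s > 0`.
  · have hpos : ∀ s : ℝ, 0 < 2 + s ^ 2 := fun s => by positivity
    have hS1 : ∀ s : ℝ, -1 < -1 + (2 + s ^ 2)⁻¹ := fun s => by
      linarith [inv_pos.2 (hpos s)]
    refine ⟨_, isOneParameterFamily_cuspProfile (S := fun s => -1 + (2 + s ^ 2)⁻¹)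
      (continuous_const.add (Continuous.inv₀ (by fun_prop) fun s => (hpos s).ne')) hS1
      (fun s hs s' hs' h => ?_) fun s _ => ?_⟩
    · have h' : s ^ 2 = s' ^ 2 := by simpa using h
      exact (sq_eq_sq₀ hs.1.le hs'.1.le).1 h'
    · refine div_pos_of_neg_of_neg hc (cuspDenom_neg (hS1 s) ?_)
      have : (2 + s ^ 2)⁻¹ ≤ 2⁻¹ := inv_anti₀ two_pos (by linarith [sq_nonneg s])
      linarith
  -- Squaring keeps the parameter nonnegative on the whole line and is injective on `(0, 1)`.
  · exact ⟨_, isOneParameterFamily_cuspProfile (S := fun s => s ^ 2) (by fun_prop)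
      (fun s => by linarith [sq_nonneg s])
      (fun s hs s' hs' h => (sq_eq_sq₀ hs.1.le hs'.1.le).1 h)
      fun s _ => div_pos hc (cuspDenom_pos (sq_nonneg s))⟩

end MuHS

theorem mainTheorem8 (c : ℝ) (hc : c ≠ 0) :
    (∃ Φ : ℝ → ℝ → ℝ, MuHS.IsOneParameterFamily (MuHS.IsSmoothWave c) Φ) ∧
      (∃ Φ : ℝ → ℝ → ℝ, MuHS.IsOneParameterFamily (MuHS.IsCuspedWave c) Φ) :=
  ⟨⟨_, MuHS.exists_smooth_family hc⟩, MuHS.exists_cusped_family hc⟩
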